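/- Let $R$ be a nonzero associative ring with $1$. A submonoid $S$ of $(R,\cdot)$ with $0\notin S$ is a \emph{left Ore set} if $Sr\cap Rs\neq\emptyset$ for all $r\in R$, $s\in S$; a left Ore set $S$ is a \emph{left denominator set} if $rs=0$ with $r\in R$, $s\in S$ implies $tr=0$ for some $t\in S$. For such $S$ let $S^{-1}R$ be the left (Ore) localization of $R$ at $S$ and $\mathrm{ass}(S)=\{r\in R : sr=0 \text{ for some } s\in S\}$. Let $\mathcal L^s_l(R)$ be the intersection of all left denominator sets of $R$ that are maximal with respect to inclusion. Let $T_l(R)$ be the union of all left denominator sets of $R$ contained in $\mathcal L^s_l(R)$; it is itself a left denominator set, the largest one contained in $\mathcal L^s_l(R)$. Put $Q^s_l(R)=T_l(R)^{-1}R$ and $\mathfrak l^s_R=\mathrm{ass}(T_l(R))$. Let $\mathcal C_R$ be the set of regular elements of $R$ (those that are neither left nor right zero divisors) and, if $\mathcal C_R$ is a left denominator set, let $Q_{l,cl}(R)=\mathcal C_R^{-1}R$ be the classical left quotient ring. \textbf{Theorem.} Let $R$ be a nonzero semiprime left Goldie ring, that is, $aRa=0$ implies $a=0$ for $a\in R$,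 $R$ satisfies the ascending chain condition on left annihilators of subsets, and $R$ contains no infinite direct sum of nonzero left ideals. Then: \begin{enumerate} \item $\mathcal C_R$ is a left denominator set, so that $Q_{l,cl}(R)$ exists, and $Q^s_l(R)=Q_{l,cl}(R)$, i.e. there is a ring isomorphism $Q^s_l(R)\to Q_{l,cl}(R)$ that commutes with the canonical homomorphisms from $R$; \item $\mathfrak l^s_R=0$; \item $T_l(R)=\mathcal C_R$. \end{enumerate} -/

import Mathlib

/-!
Left denominator sets of a ring, Ore localization at them, the strong left localization objects,
and semiprime left Goldie rings.
-/

namespace LeftDen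

universe u

section Basic

variable {R : Type u} [Ring R]

/-- A multiplicative subset `S` of `R` (a submonoid of `(R, *)` with `0 ∉ S`) is a left Ore set if
`S r ∩ R s ≠ ∅` for all `r ∈ R` and `s ∈ S`. -/
structure IsLeftOreSet (S : Submonoid R) : Prop where
  zero_notMem : (0 : R) ∉ S
  ore : ∀ r : R, ∀ s ∈ S, ∃ s' ∈ S, ∃ r' : R, s' * r = r' * s

/-- A left Ore set `S` is a left denominator set if `r s = 0` with `s ∈ S` implies `t r = 0` for
some `t ∈ S`. -/
structure IsLeftDenominatorSet (S : Submonoid R) : Prop extends IsLeftOreSet S where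
  reversible : ∀ r : R, ∀ s ∈ S, r * s = 0 → ∃ t ∈ S, t * r = 0

/-- `ass(S) = {r ∈ R | s r = 0 for some s ∈ S}`. -/
def ass (S : Submonoid R) : Set R := {r | ∃ s ∈ S, s * r = 0}

/-- A left denominator set carries Mathlib's Ore data (for some choice of numerators and
denominators; the localization does not depend on that choice). -/
theorem IsLeftDenominatorSet.nonempty_oreSet {S : Submonoid R} (hS : IsLeftDenominatorSet S) :
    Nonempty (OreLocalization.OreSet S) := by
  rw [OreLocalization.nonempty_oreSet_iff]
  refine ⟨fun a b s h => ?_, fun r s => ?_⟩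
  · obtain ⟨t, ht, h0⟩ := hS.reversible (a - b) s s.2 (by rw [sub_mul, h, sub_self])
    exact ⟨⟨t, ht⟩, by rwa [mul_sub, sub_eq_zero] at h0⟩
  · obtain ⟨s', hs', r', h⟩ := hS.ore r s s.2
    exact ⟨r', ⟨s', hs'⟩, h⟩

/-- The Ore data of a left denominator set. -/
@[reducible]
noncomputable def IsLeftDenominatorSet.oreSet {S : Submonoid R} (hS : IsLeftDenominatorSet S) :
    OreLocalization.OreSet S :=
  Classical.choice hS.nonempty_oreSet

/-- The left localization `S⁻¹R` of `R` at a left denominator set `S`: Mathlib's (left) Ore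
localization. -/
def LeftLocalization (S : Submonoid R) (hS : IsLeftDenominatorSet S) : Type u :=
  letI := hS.oreSet
  OreLocalization S R

noncomputable instance (S : Submonoid R) (hS : IsLeftDenominatorSet S) :
    Ring (LeftLocalization S hS) :=
  letI := hS.oreSet
  inferInstanceAs (Ring (OreLocalization S R))

/-- The canonical ring homomorphism `R → S⁻¹R`, `r ↦ r/1`. -/
noncomputable def toLeftLocalization (S : Submonoid R) (hS : IsLeftDenominatorSet S) :
    R →+* LeftLocalization S hS :=
  letI := hS.oreSet
  (OreLocalization.numeratorRingHom : R →+* OreLocalization S R)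

/-- The maximal left denominator sets of `R` (maximal with respect to inclusion). -/
def IsMaxLeftDenominatorSet (S : Submonoid R) : Prop := Maximal IsLeftDenominatorSet S

variable (R) in
/-- The set of strongly left localizable elements: the intersection of all maximal left
denominator sets of `R`. -/
def stronglyLeftLocalizable : Set R :=
  {c | ∀ S : Submonoid R, IsMaxLeftDenominatorSet S → c ∈ S}

/-- The strong left denominator sets of `R`: those contained in the set of strongly left
localizable elements. -/
structure IsStrongLeftDenominatorSet (T : Submonoid R) : Prop extends IsLeftDenominatorSet T where
  subset : (T : Set R) ⊆ stronglyLeftLocalizable R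

/-! Helper facts: the union of all strong left denominator sets is a left denominator set. -/

theorem isLeftDenominatorSet_bot [Nontrivial R] :
    IsLeftDenominatorSet (⊥ : Submonoid R) where
  zero_notMem := by simp [Submonoid.mem_bot]
  ore r s hs := by
    rw [Submonoid.mem_bot] at hs
    exact ⟨1, one_mem _, r, by simp [hs]⟩
  reversible r s hs h := by
    rw [Submonoid.mem_bot] at hs
    exact ⟨1, one_mem _, by simpa [hs] using h⟩

theorem IsLeftDenominatorSet.exists_le_max {S : Submonoid R} (hS : IsLeftDenominatorSet S) :
    ∃ M : Submonoid R, S ≤ M ∧ IsMaxLeftDenominatorSet M := by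
  refine zorn_le_nonempty₀ {T : Submonoid R | IsLeftDenominatorSet T} ?_ S hS
  intro c hc hchain T hT
  have hdir : DirectedOn (· ≤ ·) c := hchain.directedOn
  have hmem : ∀ x, x ∈ sSup c ↔ ∃ s ∈ c, x ∈ s := fun x =>
    Submonoid.mem_sSup_of_directedOn ⟨T, hT⟩ hdir
  refine ⟨sSup c, ⟨⟨fun h0 => ?_, fun r s hs => ?_⟩, fun r s hs h => ?_⟩, fun z hz => le_sSup hz⟩
  · obtain ⟨U, hU, h⟩ := (hmem _).1 h0
    exact (hc hU).zero_notMem h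
  · obtain ⟨U, hU, hsU⟩ := (hmem _).1 hs
    obtain ⟨s', hs', r', h⟩ := (hc hU).ore r s hsU
    exact ⟨s', (hmem _).2 ⟨U, hU, hs'⟩, r', h⟩
  · obtain ⟨U, hU, hsU⟩ := (hmem _).1 hs
    obtain ⟨t, ht, h⟩ := (hc hU).reversible r s hsU h
    exact ⟨t, (hmem _).2 ⟨U, hU, ht⟩, h⟩

theorem IsStrongLeftDenominatorSet.sup {S T : Submonoid R} (hS : IsStrongLeftDenominatorSet S)
    (hT : IsStrongLeftDenominatorSet T) : IsStrongLeftDenominatorSet (S ⊔ T) := by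
  have hsub : ((S ⊔ T : Submonoid R) : Set R) ⊆ stronglyLeftLocalizable R := fun x hx M hM =>
    (sup_le (fun y hy => hS.subset hy M hM) (fun y hy => hT.subset hy M hM) : S ⊔ T ≤ M) hx
  have hsup : S ⊔ T = Submonoid.closure ((S : Set R) ∪ T) := by
    rw [Submonoid.closure_union, Submonoid.closure_eq, Submonoid.closure_eq]
  refine ⟨⟨⟨?_, ?_⟩, ?_⟩, hsub⟩
  · intro h0
    obtain ⟨M, -, hM⟩ := hS.toIsLeftDenominatorSet.exists_le_max
    exact hM.prop.zero_notMem (hsub h0 M hM)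
  · intro r s hs
    have hs' : s ∈ Submonoid.closure ((S : Set R) ∪ T) := hsup ▸ hs
    induction hs' using Submonoid.closure_induction generalizing r with
    | mem x hx =>
      rcases hx with hx | hx
      · obtain ⟨s', h1, r', h2⟩ := hS.ore r x hx
        exact ⟨s', (le_sup_left : S ≤ S ⊔ T) h1, r', h2⟩
      · obtain ⟨s', h1, r', h2⟩ := hT.ore r x hx
        exact ⟨s', (le_sup_right : T ≤ S ⊔ T) h1, r', h2⟩
    | one => exact ⟨1, one_mem _, r, by simp⟩
    | mul x y hx hy ihx ihy =>
      obtain ⟨s₁, h1, r₁, e1⟩ := ihy r (hsup ▸ hy)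
      obtain ⟨s₂, h2, r₂, e2⟩ := ihx r₁ (hsup ▸ hx)
      exact ⟨s₂ * s₁, mul_mem h2 h1, r₂, by
        rw [mul_assoc, e1, ← mul_assoc, e2, mul_assoc]⟩
  · intro r s hs h
    have hs' : s ∈ Submonoid.closure ((S : Set R) ∪ T) := hsup ▸ hs
    induction hs' using Submonoid.closure_induction generalizing r with
    | mem x hx =>
      rcases hx with hx | hx
      · obtain ⟨t, h1, h2⟩ := hS.reversible r x hx h
        exact ⟨t, (le_sup_left : S ≤ S ⊔ T) h1, h2⟩
      · obtain ⟨t, h1, h2⟩ := hT.reversible r x hx h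
        exact ⟨t, (le_sup_right : T ≤ S ⊔ T) h1, h2⟩
    | one => exact ⟨1, one_mem _, by simpa using h⟩
    | mul x y hx hy ihx ihy =>
      obtain ⟨t₁, h1, e1⟩ := ihy (r * x) (hsup ▸ hy) (by rw [mul_assoc, h])
      obtain ⟨t₂, h2, e2⟩ := ihx (t₁ * r) (hsup ▸ hx) (by rw [mul_assoc, e1])
      exact ⟨t₂ * t₁, mul_mem h2 h1, by rw [mul_assoc, e2]⟩

end Basic

section Strong

variable (R : Type u) [Ring R] [Nontrivial R]

theorem isStrongLeftDenominatorSet_bot : IsStrongLeftDenominatorSet (⊥ : Submonoid R) where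
  toIsLeftDenominatorSet := isLeftDenominatorSet_bot
  subset x hx M _ := by
    have hx1 : x = 1 := Submonoid.mem_bot.1 hx
    exact hx1 ▸ one_mem M

/-- The largest strong left denominator set `T_l(R)`: the union of all strong left denominator
sets of `R`. -/
def largestStrongLeftDenominatorSet : Submonoid R where
  carrier := {x | ∃ T : Submonoid R, IsStrongLeftDenominatorSet T ∧ x ∈ T}
  one_mem' := ⟨⊥, isStrongLeftDenominatorSet_bot R, one_mem _⟩
  mul_mem' := by
    rintro a b ⟨S, hS, ha⟩ ⟨T, hT, hb⟩
    exact ⟨S ⊔ T, hS.sup hT,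
      mul_mem ((le_sup_left : S ≤ S ⊔ T) ha) ((le_sup_right : T ≤ S ⊔ T) hb)⟩

/-- `T_l(R)` is a left denominator set, so that `R` can be localized at it. -/
theorem isLeftDenominatorSet_largestStrong :
    IsLeftDenominatorSet (largestStrongLeftDenominatorSet R) where
  zero_notMem := fun ⟨_, hT, h⟩ => hT.zero_notMem h
  ore := by
    rintro r s ⟨T, hT, hs⟩
    obtain ⟨s', hs', r', h⟩ := hT.ore r s hs
    exact ⟨s', ⟨T, hT, hs'⟩, r', h⟩
  reversible := by
    rintro r s ⟨T, hT, hs⟩ h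
    obtain ⟨t, ht, h'⟩ := hT.reversible r s hs h
    exact ⟨t, ⟨T, hT, ht⟩, h'⟩

/-- The strong left localization radical `ass(T_l(R))` of `R`. -/
def strongLeftLocalizationRadical : Set R := ass (largestStrongLeftDenominatorSet R)

/-- The largest strong left quotient ring `Q_l^s(R) = T_l(R)⁻¹R`. -/
abbrev LargestStrongLeftQuotientRing : Type u :=
  LeftLocalization (largestStrongLeftDenominatorSet R) (isLeftDenominatorSet_largestStrong R)

/-- The canonical homomorphism `R → Q_l^s(R)`. -/
noncomputable abbrev toLargestStrongLeftQuotientRing : R →+* LargestStrongLeftQuotientRing R :=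
  toLeftLocalization (largestStrongLeftDenominatorSet R) (isLeftDenominatorSet_largestStrong R)

end Strong

section Classical

variable (R : Type u) [Ring R]

/-- The classical left quotient ring `Q_{l,cl}(R) = C⁻¹R`, where `C` is the set of regular elements
(`nonZeroDivisors R`: the elements that are neither left nor right zero divisors). It exists only
when `C` is a left denominator set. -/
abbrev ClassicalLeftQuotientRing (hC : IsLeftDenominatorSet (nonZeroDivisors R)) : Type u :=
  LeftLocalization (nonZeroDivisors R) hC

/-- The canonical homomorphism `R → Q_{l,cl}(R)`. -/
noncomputable abbrev toClassicalLeftQuotientRing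
    (hC : IsLeftDenominatorSet (nonZeroDivisors R)) : R →+* ClassicalLeftQuotientRing R hC :=
  toLeftLocalization (nonZeroDivisors R) hC

end Classical

section Goldie

/-- A ring is semiprime if `a R a = 0` implies `a = 0` (equivalently, it has no nonzero nilpotent
ideals). -/
def IsSemiprimeRing (R : Type u) [Ring R] : Prop :=
  ∀ a : R, (∀ r : R, a * r * a = 0) → a = 0

/-- The left annihilator `{r ∈ R | r x = 0 for all x ∈ X}` of a subset `X ⊆ R`, a left ideal. -/
def leftAnnihilator {R : Type u} [Ring R] (X : Set R) : Submodule R R where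
  carrier := {r | ∀ x ∈ X, r * x = 0}
  zero_mem' := fun x _ => zero_mul x
  add_mem' := fun ha hb x hx => by rw [add_mul, ha x hx, hb x hx, add_zero]
  smul_mem' := fun c a ha x hx => by rw [smul_eq_mul, mul_assoc, ha x hx, mul_zero]

/-- A ring is left Goldie if it satisfies the ascending chain condition on left annihilators (of
subsets) and contains no infinite direct sum of nonzero left ideals. -/
structure IsLeftGoldieRing (R : Type u) [Ring R] : Prop where
  acc_leftAnnihilator : ∀ X : ℕ → Set R, Monotone (fun n => leftAnnihilator (X n)) →
    ∃ n, ∀ m, n ≤ m → leftAnnihilator (X m) = leftAnnihilator (X n)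
  no_infinite_directSum : ¬ ∃ I : ℕ → Submodule R R, iSupIndep I ∧ ∀ n, I n ≠ ⊥

end Goldie

end LeftDen

/-!
The proof rests on an elementwise version of Goldie's theorem.  A left ideal `L` is essential if
every nonzero element has a nonzero left multiple in `L`.  In a semiprime left Goldie ring no
nonzero element has an essential left annihilator (the left singular ideal vanishes); hence a
strict inclusion of left annihilators is never essential, and the absence of infinite direct sums
gives the descending chain condition on left annihilators (`exists_minimal_leftAnnihilator`).  This
yields a regular element in every essential left ideal (`exists_mem_nonZeroDivisors`), and so the
left Ore condition for the set `C` of regular elements (`isLeftDenominatorSet_nonZeroDivisors`).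

It remains to see that `C` is the intersection of all maximal left denominator sets; then `C` is
itself the largest strong left denominator set.  Write `A(s) = {x | x R s = 0} = {x | s R x = 0}`.
The descending chain condition shows that `ass M = A(s)` for some `s ∈ M`, for each left
denominator set `M` (`exists_ass_eq_biAnnihilator`).

* `C` lies in each maximal `M`: elements of both `C` and `M` are left regular modulo the ideal
  `A(s) = ass M`, so the join of `C` and `M` does not contain `0`; it is a left denominator set,
  whence it equals `M` (`nonZeroDivisors_le_of_isMax`).
* For each `r ≠ 0` there is a maximal `M` with `r ∉ ass M` (`exists_isMax_notMem_ass`): take `A(s)`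
  maximal among the proper ideals of this form that contain `A(r)`.  Then `r ∉ A(s)` and `C + A(s)`
  is a left denominator set, with `ass (C + A(s)) ⊇ A(s)`; for each maximal `M` containing it,
  `ass M = A(s)` by maximality of `A(s)`.  An element in all maximal left denominator sets is
  therefore neither a left nor a right zero divisor.
-/

namespace LeftDen

universe u

variable {R : Type u} [Ring R]

/-! ### Essential left ideals and chain conditions on left annihilators -/

theorem mem_leftAnnihilator {X : Set R} {r : R} :
    r ∈ leftAnnihilator X ↔ ∀ x ∈ X, r * x = 0 := Iff.rfl

theorem mem_leftAnnihilator_singleton {r x : R} :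
    r ∈ leftAnnihilator {x} ↔ r * x = 0 := by
  simp [mem_leftAnnihilator]

theorem leftAnnihilator_anti {X Y : Set R} (h : X ⊆ Y) :
    leftAnnihilator Y ≤ leftAnnihilator X :=
  fun _ hr x hx => hr x (h hx)

/-- A left ideal `L` is essential if every nonzero element of the ring has a nonzero left multiple
in `L`; equivalently, `L` meets every nonzero left ideal nontrivially. -/
def IsEssentialLeftIdeal (L : Submodule R R) : Prop :=
  ∀ x : R, x ≠ 0 → ∃ t : R, t * x ≠ 0 ∧ t * x ∈ L

theorem IsEssentialLeftIdeal.mono {L L' : Submodule R R} (hL : IsEssentialLeftIdeal L)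
    (h : L ≤ L') : IsEssentialLeftIdeal L' := fun x hx =>
  let ⟨t, ht, htL⟩ := hL x hx
  ⟨t, ht, h htL⟩

/-- The left ideal `{t | t r ∈ L}`. -/
def colonLeft (L : Submodule R R) (r : R) : Submodule R R :=
  L.comap (LinearMap.toSpanSingleton R R r)

theorem mem_colonLeft {L : Submodule R R} {r t : R} : t ∈ colonLeft L r ↔ t * r ∈ L := by
  simp [colonLeft]

theorem IsEssentialLeftIdeal.colonLeft {L : Submodule R R} (hL : IsEssentialLeftIdeal L) (r : R) :
    IsEssentialLeftIdeal (colonLeft L r) := by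
  intro x hx
  by_cases h : x * r = 0
  · exact ⟨1, by simpa using hx, by simp [mem_colonLeft, h]⟩
  · obtain ⟨t, ht, htL⟩ := hL _ h
    rw [← mul_assoc] at ht htL
    exact ⟨t, left_ne_zero_of_mul ht, mem_colonLeft.2 htL⟩

/-- A sequence of submodules is independent if each member is disjoint from a submodule that
contains all later ones. -/
theorem iSupIndep_of_disjoint_tail {M : Type*} [AddCommGroup M] [Module R M]
    (I J : ℕ → Submodule R M) (hJ : ∀ n m, n < m → I m ≤ J n) (hd : ∀ n, Disjoint (I n) (J n)) :
    iSupIndep I := by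
  classical
  rw [iSupIndep_iff_forall_dfinsupp]
  by_contra! hcon
  obtain ⟨i, x, f, hf, hx⟩ := hcon
  -- The sum `x - ∑ f j` over `j ≠ i` vanishes; its component of least index lies in the tail.
  set g : Π₀ n, I n := DFinsupp.single i x - f.erase i with hg
  have hsum : DFinsupp.lsum ℕ (fun n => (I n).subtype) g = 0 := by
    rw [hg, map_sub, sub_eq_zero]
    simpa using hf.symm
  have hgi : g i = x := by simp [hg]
  have hne : g.support.Nonempty := ⟨i, by
    rw [DFinsupp.mem_support_iff, hgi]; simpa using hx⟩
  set n := g.support.min' hne with hn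
  have hnmem : n ∈ g.support := g.support.min'_mem hne
  have hsum' : ∑ m ∈ g.support, (g m : M) = 0 := by
    rw [← hsum, DFinsupp.lsum_apply_apply, DFinsupp.sumAddHom_apply]
    rfl
  rw [← Finset.add_sum_erase _ _ hnmem] at hsum'
  have htail : ∑ m ∈ g.support.erase n, (g m : M) ∈ J n := by
    refine Submodule.sum_mem _ fun m hm => hJ n m ?_ (g m).2
    exact lt_of_le_of_ne (g.support.min'_le _ (Finset.mem_of_mem_erase hm))
      (Finset.ne_of_mem_erase hm).symm
  have h0 := Submodule.disjoint_def.1 (hd n) (g n) (g n).2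
    (by rw [eq_neg_of_add_eq_zero_left hsum']; exact neg_mem htail)
  rw [DFinsupp.mem_support_iff] at hnmem
  exact hnmem (Subtype.ext h0)

/-- In a left Goldie ring, every nonempty family of left annihilators has a maximal member. -/
theorem IsLeftGoldieRing.exists_maximal_leftAnnihilator (hG : IsLeftGoldieRing R)
    (P : Set R → Prop) (hP : ∃ X, P X) :
    ∃ X, P X ∧ ∀ Y, P Y → leftAnnihilator X ≤ leftAnnihilator Y →
      leftAnnihilator Y ≤ leftAnnihilator X := by
  by_contra! hcon
  choose! F hF1 hF2 hF3 using hcon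
  obtain ⟨X₀, h₀⟩ := hP
  have hmem : ∀ n, P (F^[n] X₀) := by
    intro n
    induction n with
    | zero => exact h₀
    | succ n ih => rw [Function.iterate_succ_apply']; exact hF1 _ ih
  have hmono : Monotone fun n => leftAnnihilator (F^[n] X₀) := monotone_nat_of_le_succ fun n => by
    simp only [Function.iterate_succ_apply']
    exact hF2 _ (hmem n)
  obtain ⟨n, hn⟩ := hG.acc_leftAnnihilator _ hmono
  have h := hn (n + 1) n.le_succ
  rw [Function.iterate_succ_apply'] at h
  exact hF3 _ (hmem n) h.le

/-! ### Goldie's theorem -/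

/-- The left singular ideal of a semiprime left Goldie ring vanishes. -/
theorem eq_zero_of_isEssential_leftAnnihilator (hsp : IsSemiprimeRing R)
    (hG : IsLeftGoldieRing R) {z : R} (hz : IsEssentialLeftIdeal (leftAnnihilator {z})) :
    z = 0 := by
  by_contra hz0
  obtain ⟨-, ⟨z, rfl, hz0, hz⟩, hmax⟩ := hG.exists_maximal_leftAnnihilator
    (fun X => ∃ z : R, X = {z} ∧ z ≠ 0 ∧ IsEssentialLeftIdeal (leftAnnihilator {z}))
    ⟨_, z, rfl, hz0, hz⟩
  have key : ∀ r, IsEssentialLeftIdeal (leftAnnihilator {r * z}) := fun r =>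
    (hz.colonLeft r).mono fun t ht => by
      rw [mem_colonLeft, mem_leftAnnihilator_singleton, mul_assoc] at ht
      exact mem_leftAnnihilator_singleton.2 ht
  refine hz0 (hsp z fun r => ?_)
  by_contra hne
  -- The annihilator of `r z` meets `R z`, which makes that of `z r z` strictly larger.
  have hle := hmax {z * r * z} ⟨_, rfl, hne, key (z * r)⟩ fun t ht => by
    rw [mem_leftAnnihilator_singleton] at ht ⊢
    rw [← mul_assoc, ← mul_assoc, ht, zero_mul, zero_mul]
  obtain ⟨u, hu, hu'⟩ := key r z hz0
  refine hu (mem_leftAnnihilator_singleton.1 (hle ?_))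
  rw [mem_leftAnnihilator_singleton] at hu' ⊢
  rw [← hu']
  noncomm_ring

/-- In a semiprime left Goldie ring, every nonempty family of left annihilators has a minimal
member: an infinite strictly descending chain would split off an infinite direct sum, since no
left annihilator is essential in a strictly larger one. -/
theorem exists_minimal_leftAnnihilator (hsp : IsSemiprimeRing R) (hG : IsLeftGoldieRing R)
    (P : Set R → Prop) (hP : ∃ X, P X) :
    ∃ X, P X ∧ ∀ Y, P Y → leftAnnihilator Y ≤ leftAnnihilator X →
      leftAnnihilator X ≤ leftAnnihilator Y := by
  by_contra! hcon
  choose! F hF1 hF2 hF3 using hcon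
  obtain ⟨X₀, h₀⟩ := hP
  have hmem : ∀ n, P (F^[n] X₀) := by
    intro n
    induction n with
    | zero => exact h₀
    | succ n ih => rw [Function.iterate_succ_apply']; exact hF1 _ ih
  have hanti : Antitone fun n => leftAnnihilator (F^[n] X₀) := antitone_nat_of_succ_le fun n => by
    simp only [Function.iterate_succ_apply']
    exact hF2 _ (hmem n)
  have hex : ∀ n, ∃ y ∈ leftAnnihilator (F^[n] X₀), y ≠ 0 ∧
      ∀ t, t * y ∈ leftAnnihilator (F^[n + 1] X₀) → t * y = 0 := by
    intro n
    by_contra! hno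
    refine hF3 _ (hmem n) fun r hr x hx => ?_
    rw [← Function.iterate_succ_apply' F n X₀] at hx
    refine eq_zero_of_isEssential_leftAnnihilator hsp hG fun z hz => ?_
    by_cases hzr : z * r = 0
    · exact ⟨1, by simpa using hz, by
        rw [mem_leftAnnihilator_singleton, one_mul, ← mul_assoc, hzr, zero_mul]⟩
    · obtain ⟨t, ht, ht0⟩ := hno (z * r) (Submodule.smul_mem _ z hr) hzr
      refine ⟨t, fun h => ht0 (by rw [← mul_assoc, h, zero_mul]), ?_⟩
      rw [mem_leftAnnihilator_singleton, ← mul_assoc, mul_assoc t z r]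
      exact ht x hx
  choose y hy hy0 hyd using hex
  refine hG.no_infinite_directSum ⟨fun n => Submodule.span R {y n},
    iSupIndep_of_disjoint_tail _ (fun n => leftAnnihilator (F^[n + 1] X₀)) (fun n m h => ?_)
      (fun n => ?_), fun n => by simpa using hy0 n⟩
  · rw [Submodule.span_singleton_le_iff_mem]
    exact hanti (Nat.succ_le_of_lt h) (hy m)
  · rw [Submodule.disjoint_def]
    intro x hx hx'
    obtain ⟨t, rfl⟩ := Submodule.mem_span_singleton.1 hx
    exact hyd n t hx'

/-- If `c` is not a right zero divisor, then `R c` is an essential left ideal: otherwise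
`R x ∩ R c = 0` for some `x ≠ 0`, and the left ideals `R x c ^ n` form an infinite direct sum. -/
theorem IsLeftGoldieRing.isEssential_span_singleton (hG : IsLeftGoldieRing R) {c : R}
    (hc : ∀ t, t * c = 0 → t = 0) : IsEssentialLeftIdeal (Submodule.span R {c}) := by
  by_contra hne
  simp only [IsEssentialLeftIdeal, not_forall, not_exists, not_and] at hne
  obtain ⟨x, hx0, hx⟩ := hne
  have hx' : ∀ t w : R, t * x = w * c → t * x = 0 := fun t w h => by
    by_contra h0
    exact hx t h0 (Submodule.mem_span_singleton.2 ⟨w, h.symm⟩)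
  have hcn : ∀ n t, t * c ^ n = 0 → t = 0 := by
    intro n
    induction n with
    | zero => intro t ht; simpa using ht
    | succ n ih => intro t ht; exact ih t (hc _ (by rwa [mul_assoc, ← pow_succ]))
  refine hG.no_infinite_directSum ⟨fun n => Submodule.span R {x * c ^ n},
    iSupIndep_of_disjoint_tail _ (fun n => Submodule.span R {c ^ (n + 1)}) (fun n m h => ?_)
      (fun n => ?_), fun n => ?_⟩
  · rw [Submodule.span_singleton_le_iff_mem]
    obtain ⟨k, rfl⟩ := Nat.exists_eq_add_of_le' (Nat.succ_le_of_lt h)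
    exact Submodule.mem_span_singleton.2 ⟨x * c ^ k, by rw [smul_eq_mul, mul_assoc, ← pow_add]⟩
  · rw [Submodule.disjoint_def]
    intro z hz hz'
    obtain ⟨t, rfl⟩ := Submodule.mem_span_singleton.1 hz
    obtain ⟨w, hw⟩ := Submodule.mem_span_singleton.1 hz'
    simp only [smul_eq_mul] at hw ⊢
    have h0 : t * x - w * c = 0 := hcn n _ (by
      rw [sub_mul, mul_assoc w, ← pow_succ', hw, mul_assoc, sub_self])
    rw [← mul_assoc, hx' t w (sub_eq_zero.1 h0), zero_mul]
  · rw [Ne, Submodule.span_singleton_eq_bot]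
    exact fun h => hx0 (hcn n x h)

theorem mem_nonZeroDivisors_of_right (hsp : IsSemiprimeRing R) (hG : IsLeftGoldieRing R) {c : R}
    (hc : ∀ t, t * c = 0 → t = 0) : c ∈ nonZeroDivisors R := by
  refine mem_nonZeroDivisors_iff.2 ⟨fun x hx => ?_, hc⟩
  refine eq_zero_of_isEssential_leftAnnihilator hsp hG
    ((hG.isEssential_span_singleton hc).mono ?_)
  rwa [Submodule.span_singleton_le_iff_mem, mem_leftAnnihilator_singleton]

/-- A nonzero left ideal of a semiprime left Goldie ring contains a nonzero `u` such that `u` and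
`u ^ 2` have the same left annihilator; in particular it is not nil. -/
theorem exists_mem_mul_self_cancel (hsp : IsSemiprimeRing R) (hG : IsLeftGoldieRing R)
    {K : Submodule R R} {k : R} (hk : k ∈ K) (hk0 : k ≠ 0) :
    ∃ u ∈ K, u ≠ 0 ∧ ∀ t, t * u * u = 0 → t * u = 0 := by
  obtain ⟨-, ⟨r, rfl, hb0⟩, hmax⟩ := hG.exists_maximal_leftAnnihilator
    (fun X => ∃ r : R, X = {k * r} ∧ k * r ≠ 0) ⟨_, 1, rfl, by simpa using hk0⟩
  -- Every nonzero right multiple of `b = k r` has the same left annihilator as `b`.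
  have hb : ∀ w t, k * r * w ≠ 0 → t * (k * r * w) = 0 → t * (k * r) = 0 := by
    intro w t hw ht
    refine mem_leftAnnihilator_singleton.1 (hmax {k * r * w} ⟨r * w, by rw [mul_assoc], by
      rwa [← mul_assoc]⟩ (fun s hs => ?_) (mem_leftAnnihilator_singleton.2 ht))
    rw [mem_leftAnnihilator_singleton] at hs ⊢
    rw [← mul_assoc, hs, zero_mul]
  obtain ⟨s, hs⟩ : ∃ s, k * r * s * (k * r) ≠ 0 := by
    by_contra! h
    exact hb0 (hsp _ h)
  set q := r * s with hq
  have hv0 : k * q ≠ 0 := fun h => hs (by rw [mul_assoc k r s, ← hq, h, zero_mul])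
  have hvsq : ∀ t, t * (k * q) * (k * q) = 0 → t * (k * q) = 0 := by
    intro t ht
    have h1 : t * (k * q) * (k * r) = 0 := by
      refine hb (s * (k * r)) (t * (k * q)) (by rwa [← mul_assoc]) ?_
      have : t * (k * q) * (k * r * (s * (k * r))) = t * (k * q) * (k * q) * (k * r) := by
        rw [hq]; noncomm_ring
      rw [this, ht, zero_mul]
    have h2 : t * (k * r) = 0 := by
      refine hb (s * (k * r)) t (by rwa [← mul_assoc]) ?_
      rw [← h1, hq]; noncomm_ring
    rw [hq, ← mul_assoc k, ← mul_assoc, h2, zero_mul]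
  -- Since `t v ^ 2 = 0` implies `t v = 0` for `v = k q`, the same holds for `(q k) ^ 2 ∈ K`.
  refine ⟨q * k * q * k, Submodule.smul_mem _ _ hk, fun h => hv0 ?_, fun t ht => ?_⟩
  · have h1 : 1 * (k * q) = 0 := hvsq _ (hvsq _ (by
      calc 1 * (k * q) * (k * q) * (k * q) = k * (q * k * q * k) * q := by noncomm_ring
        _ = 0 := by rw [h, mul_zero, zero_mul]))
    rwa [one_mul] at h1
  · have h1 : t * q * (k * q) = 0 := hvsq _ (hvsq _ (hvsq _ (by
      calc t * q * (k * q) * (k * q) * (k * q) * (k * q)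
          = t * (q * k * q * k) * (q * k * q * k) * q := by noncomm_ring
        _ = 0 := by rw [ht, zero_mul])))
    calc t * (q * k * q * k) = t * q * (k * q) * k := by noncomm_ring
      _ = 0 := by rw [h1, zero_mul]

/-- An essential left ideal of a semiprime left Goldie ring contains a regular element. -/
theorem exists_mem_nonZeroDivisors (hsp : IsSemiprimeRing R) (hG : IsLeftGoldieRing R)
    {L : Submodule R R} (hL : IsEssentialLeftIdeal L) : ∃ c ∈ L, c ∈ nonZeroDivisors R := by
  obtain ⟨-, ⟨c, rfl, hcL, hc⟩, hmin⟩ := exists_minimal_leftAnnihilator hsp hG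
    (fun X => ∃ c : R, X = {c} ∧ c ∈ L ∧ ∀ t, t * c * c = 0 → t * c = 0)
    ⟨_, 0, rfl, zero_mem _, by simp⟩
  refine ⟨c, hcL, mem_nonZeroDivisors_of_right hsp hG fun z hz => ?_⟩
  by_contra hz0
  -- If `z c = 0` with `z ≠ 0`, then adding to `c` a suitable `u` from `L` with `u c = 0` makes
  -- the left annihilator strictly smaller.
  obtain ⟨a, ha0, haL⟩ := hL z hz0
  have hac : a * z ∈ L ⊓ leftAnnihilator {c} := ⟨haL, by
    rw [SetLike.mem_coe, mem_leftAnnihilator_singleton, mul_assoc, hz, mul_zero]⟩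
  obtain ⟨u, ⟨huL, huc⟩, hu0, hu⟩ := exists_mem_mul_self_cancel hsp hG hac ha0
  rw [SetLike.mem_coe, mem_leftAnnihilator_singleton] at huc
  have hsplit : ∀ t, t * (c + u) = 0 → t * c = 0 ∧ t * u = 0 := by
    intro t ht
    rw [mul_add] at ht
    have h1 : t * c = 0 := hc t (by
      rw [eq_neg_of_add_eq_zero_left ht, neg_mul, mul_assoc, huc, mul_zero, neg_zero])
    exact ⟨h1, by rwa [h1, zero_add] at ht⟩
  have hcu : ∀ t, t * (c + u) * (c + u) = 0 → t * (c + u) = 0 := by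
    intro t ht
    obtain ⟨h1, h2⟩ := hsplit _ ht
    rw [mul_add, add_mul, mul_assoc t u c, huc, mul_zero, add_zero] at h1
    have h3 := hc t h1
    rw [mul_add, h3, zero_add] at h2 ⊢
    exact hu t h2
  have hle := hmin {c + u} ⟨_, rfl, add_mem hcL huL, hcu⟩ fun t ht => by
    rw [mem_leftAnnihilator_singleton] at ht ⊢
    exact (hsplit t ht).1
  have huu := hle (mem_leftAnnihilator_singleton.2 huc)
  rw [mem_leftAnnihilator_singleton] at huu
  refine hu0 ?_
  simpa using hu 1 (by simpa using (hsplit u huu).2)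

/-- **Goldie's theorem**, the Ore condition: the regular elements of a nonzero semiprime left
Goldie ring form a left denominator set. -/
theorem isLeftDenominatorSet_nonZeroDivisors [Nontrivial R] (hsp : IsSemiprimeRing R)
    (hG : IsLeftGoldieRing R) : IsLeftDenominatorSet (nonZeroDivisors R) where
  zero_notMem := zero_notMem_nonZeroDivisors
  ore r c hc := by
    obtain ⟨c', hc', hreg⟩ := exists_mem_nonZeroDivisors hsp hG
      ((hG.isEssential_span_singleton (mem_nonZeroDivisors_iff.1 hc).2).colonLeft r)
    obtain ⟨r', hr'⟩ := Submodule.mem_span_singleton.1 (mem_colonLeft.1 hc')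
    exact ⟨c', hreg, r', hr'.symm⟩
  reversible r c hc h := ⟨1, one_mem _, by
    rw [one_mul]; exact (mem_nonZeroDivisors_iff.1 hc).2 r h⟩

/-! ### Annihilator ideals and the ideals `ass S` -/

/-- The ideal `A(s) = {x | x R s = 0}`, as a left ideal.  In a semiprime ring it is also
`{x | s R x = 0}`, the two-sided annihilator of the ideal generated by `s`. -/
def biAnnihilator (s : R) : Submodule R R := leftAnnihilator (Set.range fun t => t * s)

theorem mem_biAnnihilator {s x : R} : x ∈ biAnnihilator s ↔ ∀ t, x * t * s = 0 := by
  simp [biAnnihilator, mem_leftAnnihilator, mul_assoc]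

theorem IsSemiprimeRing.mul_mul_eq_zero_symm (hsp : IsSemiprimeRing R) {x y : R}
    (h : ∀ t, x * t * y = 0) (t : R) : y * t * x = 0 := by
  refine hsp _ fun r => ?_
  calc y * t * x * r * (y * t * x) = y * t * (x * r * y) * t * x := by noncomm_ring
    _ = 0 := by rw [h, mul_zero, zero_mul, zero_mul]

theorem IsSemiprimeRing.mem_biAnnihilator_iff (hsp : IsSemiprimeRing R) {s x : R} :
    x ∈ biAnnihilator s ↔ ∀ t, s * t * x = 0 :=
  mem_biAnnihilator.trans ⟨hsp.mul_mul_eq_zero_symm, hsp.mul_mul_eq_zero_symm⟩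

theorem biAnnihilator_mul_right {s x : R} (hx : x ∈ biAnnihilator s) (r : R) :
    x * r ∈ biAnnihilator s := by
  rw [mem_biAnnihilator] at hx ⊢
  intro t
  rw [mul_assoc x]
  exact hx _

theorem biAnnihilator_mul_left {s x : R} (hx : x ∈ biAnnihilator s) (r : R) :
    r * x ∈ biAnnihilator s := Submodule.smul_mem _ r hx

theorem notMem_biAnnihilator_self (hsp : IsSemiprimeRing R) {s : R} (hs : s ≠ 0) :
    s ∉ biAnnihilator s := fun h => hs (hsp s (mem_biAnnihilator.1 h))

theorem IsLeftOreSet.mul_mem_ass {M : Submonoid R} (hM : IsLeftOreSet M) {x : R}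
    (hx : x ∈ ass M) (r : R) : r * x ∈ ass M := by
  obtain ⟨s, hs, hsx⟩ := hx
  obtain ⟨s', hs', r', h⟩ := hM.ore r s hs
  exact ⟨s', hs', by rw [← mul_assoc, h, mul_assoc, hsx, mul_zero]⟩

/-- By the descending chain condition on left annihilators, a single element of a left
denominator set `M` annihilates all of `ass M`. -/
theorem exists_ass_eq_biAnnihilator (hsp : IsSemiprimeRing R) (hG : IsLeftGoldieRing R)
    {M : Submonoid R} (hM : IsLeftDenominatorSet M) :
    ∃ s ∈ M, ass M = biAnnihilator s := by
  obtain ⟨X, ⟨hX, s, hs, hsX⟩, hmin⟩ := exists_minimal_leftAnnihilator hsp hG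
    (fun X => X ⊆ ass M ∧ ∃ s ∈ M, ∀ x ∈ X, s * x = 0)
    ⟨∅, Set.empty_subset _, 1, one_mem _, by simp⟩
  have hkill : ∀ y ∈ ass M, s * y = 0 := by
    rintro y hy
    obtain ⟨s₁, hs₁, hy₁⟩ := id hy
    obtain ⟨s₂, hs₂, r, h⟩ := hM.ore s s₁ hs₁
    refine hmin (insert y X) ⟨Set.insert_subset hy hX, s₂ * s, mul_mem hs₂ hs, ?_⟩
      (leftAnnihilator_anti (Set.subset_insert _ _)) hsX y (Set.mem_insert _ _)
    rintro x (rfl | hx)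
    · rw [h, mul_assoc, hy₁, mul_zero]
    · rw [mul_assoc, hsX x hx, mul_zero]
  refine ⟨s, hs, Set.ext fun x => ?_⟩
  rw [SetLike.mem_coe, hsp.mem_biAnnihilator_iff]
  refine ⟨fun hx t => ?_, fun h => ⟨s, hs, by simpa using h 1⟩⟩
  rw [mul_assoc]
  exact hkill _ (hM.mul_mem_ass hx t)

/-! ### The intersection of the maximal left denominator sets -/

/-- The join of two left denominator sets is a left denominator set, provided that it avoids
zero. -/
theorem IsLeftDenominatorSet.sup {S T : Submonoid R} (hS : IsLeftDenominatorSet S)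
    (hT : IsLeftDenominatorSet T) (h0 : (0 : R) ∉ S ⊔ T) : IsLeftDenominatorSet (S ⊔ T) := by
  have hsup : S ⊔ T = Submonoid.closure ((S : Set R) ∪ T) := by
    rw [Submonoid.closure_union, Submonoid.closure_eq, Submonoid.closure_eq]
  refine ⟨⟨h0, fun r s hs => ?_⟩, fun r s hs h => ?_⟩
  · rw [hsup] at hs
    induction hs using Submonoid.closure_induction generalizing r with
    | mem x hx =>
      rcases hx with hx | hx
      · obtain ⟨s', h1, r', h2⟩ := hS.ore r x hx
        exact ⟨s', (le_sup_left : S ≤ S ⊔ T) h1, r', h2⟩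
      · obtain ⟨s', h1, r', h2⟩ := hT.ore r x hx
        exact ⟨s', (le_sup_right : T ≤ S ⊔ T) h1, r', h2⟩
    | one => exact ⟨1, one_mem _, r, by simp⟩
    | mul x y hx hy ihx ihy =>
      obtain ⟨s₁, h1, r₁, e1⟩ := ihy r
      obtain ⟨s₂, h2, r₂, e2⟩ := ihx r₁
      exact ⟨s₂ * s₁, mul_mem h2 h1, r₂, by
        rw [mul_assoc, e1, ← mul_assoc, e2, mul_assoc]⟩
  · rw [hsup] at hs
    induction hs using Submonoid.closure_induction generalizing r with
    | mem x hx =>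
      rcases hx with hx | hx
      · obtain ⟨t, h1, h2⟩ := hS.reversible r x hx h
        exact ⟨t, (le_sup_left : S ≤ S ⊔ T) h1, h2⟩
      · obtain ⟨t, h1, h2⟩ := hT.reversible r x hx h
        exact ⟨t, (le_sup_right : T ≤ S ⊔ T) h1, h2⟩
    | one => exact ⟨1, one_mem _, by simpa using h⟩
    | mul x y hx hy ihx ihy =>
      obtain ⟨t₁, h1, e1⟩ := ihy (r * x) (by rw [mul_assoc, h])
      obtain ⟨t₂, h2, e2⟩ := ihx (t₁ * r) (by rw [mul_assoc, e1])
      exact ⟨t₂ * t₁, mul_mem h2 h1, by rw [mul_assoc, e2]⟩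

/-- The elements that are left regular modulo a subset `I`. -/
def leftRegularMod (I : Set R) : Submonoid R where
  carrier := {c | ∀ x, c * x ∈ I → x ∈ I}
  one_mem' x hx := by rwa [one_mul] at hx
  mul_mem' ha hb x hx := hb x (ha _ (by rwa [← mul_assoc]))

theorem nonZeroDivisors_le_of_isMax [Nontrivial R] (hsp : IsSemiprimeRing R)
    (hG : IsLeftGoldieRing R) {M : Submonoid R} (hM : IsMaxLeftDenominatorSet M) :
    nonZeroDivisors R ≤ M := by
  obtain ⟨s, hs, hass⟩ := exists_ass_eq_biAnnihilator hsp hG hM.prop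
  have h1 : nonZeroDivisors R ≤ leftRegularMod (ass M) := by
    intro c hc x hx
    rw [hass, SetLike.mem_coe, mem_biAnnihilator] at hx ⊢
    exact fun t => (mem_nonZeroDivisors_iff.1 hc).1 _ (by simpa only [mul_assoc] using hx t)
  have h2 : M ≤ leftRegularMod (ass M) := by
    rintro c hc x ⟨t, ht, htx⟩
    exact ⟨t * c, mul_mem ht hc, by rwa [mul_assoc]⟩
  have h0 : (0 : R) ∉ M ⊔ nonZeroDivisors R := fun h => by
    have h' : ∀ x, (0 : R) * x ∈ ass M → x ∈ ass M := sup_le h2 h1 h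
    obtain ⟨t, ht, ht1⟩ := h' 1 ⟨1, one_mem _, by simp⟩
    rw [mul_one] at ht1
    exact hM.prop.zero_notMem (ht1 ▸ ht)
  exact le_sup_right.trans (hM.le_of_ge
    (hM.prop.sup (isLeftDenominatorSet_nonZeroDivisors hsp hG) h0) le_sup_left)

/-- The submonoid `C + A(s)` of elements congruent to a regular element modulo `A(s)`. -/
def regularAddBiAnnihilator (s : R) : Submonoid R where
  carrier := {y | ∃ c ∈ nonZeroDivisors R, ∃ x ∈ biAnnihilator s, y = c + x}
  one_mem' := ⟨1, one_mem _, 0, zero_mem _, (add_zero 1).symm⟩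
  mul_mem' := by
    rintro _ _ ⟨c, hc, x, hx, rfl⟩ ⟨d, hd, y, hy, rfl⟩
    exact ⟨c * d, mul_mem hc hd, c * y + x * (d + y),
      add_mem (biAnnihilator_mul_left hy c) (biAnnihilator_mul_right hx _), by noncomm_ring⟩

/-- The left ideal `A(s) + l.ann(A(s))` is essential, so `C + A(s)` contains an element that
annihilates `A(s)` on the left. -/
theorem exists_mem_regularAddBiAnnihilator_mul_eq_zero (hsp : IsSemiprimeRing R)
    (hG : IsLeftGoldieRing R) (s : R) :
    ∃ y ∈ regularAddBiAnnihilator s, ∀ x ∈ biAnnihilator s, y * x = 0 := by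
  have hess : IsEssentialLeftIdeal
      (biAnnihilator s ⊔ leftAnnihilator (biAnnihilator s : Set R)) := by
    intro z hz
    by_cases h : z ∈ biAnnihilator s
    · exact ⟨1, by simpa using hz, by simpa using Submodule.mem_sup_left h⟩
    · rw [hsp.mem_biAnnihilator_iff] at h
      push Not at h
      obtain ⟨t, ht⟩ := h
      refine ⟨s * t, ht, Submodule.mem_sup_right fun x hx => ?_⟩
      have hzx := biAnnihilator_mul_left hx z
      rw [hsp.mem_biAnnihilator_iff] at hzx
      rw [mul_assoc, hzx]
  obtain ⟨c, hcL, hc⟩ := exists_mem_nonZeroDivisors hsp hG hess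
  obtain ⟨x, hx, y, hy, rfl⟩ := Submodule.mem_sup.1 hcL
  exact ⟨y, ⟨x + y, hc, -x, neg_mem hx, by abel⟩, hy⟩

theorem isLeftDenominatorSet_regularAddBiAnnihilator [Nontrivial R] (hsp : IsSemiprimeRing R)
    (hG : IsLeftGoldieRing R) {s : R} (hs : s ≠ 0) :
    IsLeftDenominatorSet (regularAddBiAnnihilator s) := by
  obtain ⟨y, hy, hyA⟩ := exists_mem_regularAddBiAnnihilator_mul_eq_zero hsp hG s
  refine ⟨⟨?_, ?_⟩, ?_⟩
  · rintro ⟨c, hc, x, hx, h⟩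
    have h1 := mem_biAnnihilator.1 hx 1
    rw [eq_neg_of_add_eq_zero_right h.symm, mul_one, neg_mul, neg_eq_zero] at h1
    exact hs ((mem_nonZeroDivisors_iff.1 hc).1 s h1)
  · rintro r _ ⟨c, hc, x, hx, rfl⟩
    obtain ⟨c', hc', r', h⟩ := (isLeftDenominatorSet_nonZeroDivisors hsp hG).ore r c hc
    refine ⟨y * c', mul_mem hy ⟨c', hc', 0, zero_mem _, (add_zero c').symm⟩, y * r', ?_⟩
    rw [mul_add, mul_assoc y r' x, hyA _ (biAnnihilator_mul_left hx r'), add_zero, mul_assoc, h,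
      mul_assoc]
  · rintro r _ ⟨c, hc, x, hx, rfl⟩ h
    refine ⟨y, hy, (mem_nonZeroDivisors_iff.1 hc).2 _ ?_⟩
    have h1 : y * (r * (c + x)) = 0 := by rw [h, mul_zero]
    rwa [mul_add, mul_add, hyA _ (biAnnihilator_mul_left hx r), add_zero, ← mul_assoc] at h1

/-- The ideals `ass M`, for `M` a maximal left denominator set, intersect in zero. -/
theorem exists_isMax_notMem_ass [Nontrivial R] (hsp : IsSemiprimeRing R)
    (hG : IsLeftGoldieRing R) {r : R} (hr : r ≠ 0) :
    ∃ M : Submonoid R, IsMaxLeftDenominatorSet M ∧ r ∉ ass M := by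
  obtain ⟨-, ⟨s, rfl, hs, hrs⟩, hmax⟩ := hG.exists_maximal_leftAnnihilator
    (fun X => ∃ s : R, X = Set.range (fun t => t * s) ∧ s ≠ 0 ∧
      biAnnihilator r ≤ biAnnihilator s) ⟨_, r, rfl, hr, le_rfl⟩
  obtain ⟨M, hSM, hM⟩ := (isLeftDenominatorSet_regularAddBiAnnihilator hsp hG hs).exists_le_max
  refine ⟨M, hM, fun hrM => ?_⟩
  obtain ⟨s', hs', hass⟩ := exists_ass_eq_biAnnihilator hsp hG hM.prop
  have hs0 : s' ≠ 0 := fun h => hM.prop.zero_notMem (h ▸ hs')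
  obtain ⟨y, hy, hyA⟩ := exists_mem_regularAddBiAnnihilator_mul_eq_zero hsp hG s
  have hle : biAnnihilator s ≤ biAnnihilator s' := fun x hx => by
    rw [← SetLike.mem_coe, ← hass]
    exact ⟨y, hSM hy, hyA x hx⟩
  have hrs' : r ∈ biAnnihilator s := by
    rw [hass] at hrM
    exact hmax _ ⟨s', rfl, hs0, hrs.trans hle⟩ hle hrM
  -- `r ∈ A(s)` gives `s ∈ A(r) ⊆ A(s)`, which is impossible in a semiprime ring.
  refine notMem_biAnnihilator_self hsp hs (hrs ?_)
  rw [hsp.mem_biAnnihilator_iff]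
  exact mem_biAnnihilator.1 hrs'

theorem stronglyLeftLocalizable_eq_nonZeroDivisors [Nontrivial R] (hsp : IsSemiprimeRing R)
    (hG : IsLeftGoldieRing R) : stronglyLeftLocalizable R = nonZeroDivisors R := by
  refine Set.Subset.antisymm (fun c hc => mem_nonZeroDivisors_iff.2 ⟨fun r h => ?_, fun r h => ?_⟩)
    fun c hc M hM => nonZeroDivisors_le_of_isMax hsp hG hM hc
  · by_contra hr
    obtain ⟨M, hM, hrM⟩ := exists_isMax_notMem_ass hsp hG hr
    exact hrM ⟨c, hc M hM, h⟩
  · by_contra hr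
    obtain ⟨M, hM, hrM⟩ := exists_isMax_notMem_ass hsp hG hr
    exact hrM (hM.prop.reversible r c (hc M hM) h)

theorem largestStrongLeftDenominatorSet_eq [Nontrivial R] (hsp : IsSemiprimeRing R)
    (hG : IsLeftGoldieRing R) : largestStrongLeftDenominatorSet R = nonZeroDivisors R := by
  have h := stronglyLeftLocalizable_eq_nonZeroDivisors hsp hG
  refine le_antisymm ?_ fun c hc =>
    ⟨_, ⟨isLeftDenominatorSet_nonZeroDivisors hsp hG, h.ge⟩, hc⟩
  rintro c ⟨T, hT, hc⟩
  exact h.le (hT.subset hc)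

/-- Localizations at equal left denominator sets are isomorphic over `R`. -/
theorem exists_ringEquiv_of_eq {S T : Submonoid R} (h : S = T) (hS : IsLeftDenominatorSet S)
    (hT : IsLeftDenominatorSet T) : ∃ e : LeftLocalization S hS ≃+* LeftLocalization T hT,
      ∀ r, e (toLeftLocalization S hS r) = toLeftLocalization T hT r := by
  subst h
  exact ⟨RingEquiv.refl _, fun _ => rfl⟩

theorem ass_nonZeroDivisors : ass (nonZeroDivisors R) = {0} := by
  ext r
  refine ⟨fun ⟨s, hs, h⟩ => (mem_nonZeroDivisors_iff.1 hs).1 r h, fun h => ⟨1, one_mem _, ?_⟩⟩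
  rw [Set.mem_singleton_iff.1 h, mul_zero]

end LeftDen

theorem mainTheorem12 (R : Type*) [Ring R] [Nontrivial R]
    (hsp : LeftDen.IsSemiprimeRing R) (hG : LeftDen.IsLeftGoldieRing R) :
    (∃ hC : LeftDen.IsLeftDenominatorSet (nonZeroDivisors R),
      ∃ e : LeftDen.LargestStrongLeftQuotientRing R ≃+* LeftDen.ClassicalLeftQuotientRing R hC,
        ∀ r : R, e (LeftDen.toLargestStrongLeftQuotientRing R r) =
          LeftDen.toClassicalLeftQuotientRing R hC r) ∧
    LeftDen.strongLeftLocalizationRadical R = {0} ∧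
    LeftDen.largestStrongLeftDenominatorSet R = nonZeroDivisors R := by
  have hT := LeftDen.largestStrongLeftDenominatorSet_eq hsp hG
  refine ⟨⟨LeftDen.isLeftDenominatorSet_nonZeroDivisors hsp hG,
    LeftDen.exists_ringEquiv_of_eq hT _ _⟩, ?_, hT⟩
  rw [LeftDen.strongLeftLocalizationRadical, hT, LeftDen.ass_nonZeroDivisors]
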